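/- Let $G=(V,E)$ be a finite, simple, connected graph. A spanning tree of $G$ is a maximal acyclic subset of $E$, and a matching is a subset of $E$ that covers every vertex at most once. For $A\subseteq E$ let $e_A\in\{0,1\}^E\subset\mathbb{R}^E$ be its indicator vector, and put $$P(G)=\operatorname{conv}(e_T\mid T\text{ a spanning tree}),\qquad 2M(G)=\{2x\mid x\in M(G)\},\quad M(G)=\operatorname{conv}(e_M\mid M\text{ a matching}).$$ Let $P(G)^{\circ}$ be the relative interior of $P(G)$ in its affine span. For edge weights $c\in\mathbb{R}_{>0}^E$, the relative resistance of $e\in E$ and the resistance curvature of $v\in V$ are $$r_e(c)=\frac{\sum_{T\ni e}\prod_{t\in T}c_t}{\sum_{T}\prod_{t\in T}c_t},\qquad p_v(c)=1-\tfrac12\sum_{uv\in E}r_{uv}(c),$$ where $T$ runs over spanning trees. The graph $G$ is resistance nonnegative (RN) if there is $c\in\mathbb{R}_{>0}^E$ with $p_v(c)\ge 0$ for all $v\in V$. **Theorem.** $G$ is RN if and only if $P(G)^{\circ}\cap 2M(G)\neq\emptyset$. Moreover, every $x\in P(G)$ satisfies the rank inequalities $$0\le \sum_{e\in A}x_e\le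 |V|-\#\text{components of }(V,A)\qquad\text{for all }A\subseteq E,$$ and every $x\in\mathbb{R}^E$ that satisfies the rank inequalities also satisfies the odd-set inequalities $$\sum_{e\in E(U)}x_e\le 2\left\lfloor\tfrac12|U|\right\rfloor\qquad\text{for all }U\subseteq V\text{ of odd size},$$ where $E(U)$ is the set of edges of the subgraph induced on $U$. Accordingly, a point $x\in P(G)$ lies in $2M(G)$ if and only if $\sum_{uv\in E}x_{uv}\le 2$ for every $v\in V$. -/

import Mathlib

open scoped Pointwise

noncomputable section

namespace ResistanceGraph

variable {V : Type*} [Fintype V] (G : SimpleGraph V)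

/-- The graph on the full vertex set `V` whose edges are those in `A`. -/
def edgeSubgraph (A : Finset G.edgeSet) : SimpleGraph V :=
  SimpleGraph.fromEdgeSet ((fun e : G.edgeSet => (e : Sym2 V)) '' (A : Set G.edgeSet))

/-- A spanning tree is a maximal acyclic set of edges. -/
def IsSpanningTree (T : Finset G.edgeSet) : Prop :=
  Maximal (fun F : Finset G.edgeSet => (edgeSubgraph G F).IsAcyclic) T

/-- A matching is a set of edges that covers every vertex at most once. -/
def IsMatchingSet (M : Finset G.edgeSet) : Prop :=
  ∀ v : V, ∀ e ∈ M, ∀ f ∈ M, v ∈ (e : Sym2 V) → v ∈ (f : Sym2 V) → e = f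

open Classical in
/-- The vector `e_A = ∑_{i ∈ A} e_i` of `ℝ^E`. -/
def indicatorVector (A : Finset G.edgeSet) : G.edgeSet → ℝ :=
  fun e => if e ∈ A then 1 else 0

/-- The spanning tree polytope `P(G)`. -/
def spanningTreePolytope : Set (G.edgeSet → ℝ) :=
  convexHull ℝ {x | ∃ T : Finset G.edgeSet, IsSpanningTree G T ∧ x = indicatorVector G T}

/-- The relative interior of `P(G)`, taken in its affine span. -/
def openSpanningTreePolytope : Set (G.edgeSet → ℝ) :=
  intrinsicInterior ℝ (spanningTreePolytope G)

/-- The matching polytope `M(G)`. -/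
def matchingPolytope : Set (G.edgeSet → ℝ) :=
  convexHull ℝ {x | ∃ M : Finset G.edgeSet, IsMatchingSet G M ∧ x = indicatorVector G M}

/-- The twice-dilated matching polytope `2M(G) = {2x | x ∈ M(G)}`. -/
def doubleMatchingPolytope : Set (G.edgeSet → ℝ) :=
  (2 : ℝ) • matchingPolytope G

open Classical in
/-- The finite collection of all spanning trees. -/
def spanningTrees : Finset (Finset G.edgeSet) :=
  Finset.univ.filter fun T => IsSpanningTree G T

open Classical in
/-- The relative resistance `r_e(c)`: the `c`-weighted fraction of spanning trees containing `e`. -/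
def relativeResistance (c : G.edgeSet → ℝ) (e : G.edgeSet) : ℝ :=
  (∑ T ∈ (spanningTrees G).filter (fun T => e ∈ T), ∏ t ∈ T, c t) /
    (∑ T ∈ spanningTrees G, ∏ t ∈ T, c t)

open Classical in
/-- The edges incident to the vertex `v`. -/
def incidentEdges (v : V) : Finset G.edgeSet :=
  Finset.univ.filter fun e => v ∈ (e : Sym2 V)

open Classical in
/-- The edges `E(U)` of the subgraph induced on `U`. -/
def inducedEdges (U : Finset V) : Finset G.edgeSet :=
  Finset.univ.filter fun e => ∀ v ∈ (e : Sym2 V), v ∈ U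

/-- The resistance curvature `p_v(c)`. -/
def resistanceCurvature (c : G.edgeSet → ℝ) (v : V) : ℝ :=
  1 - (1 / 2 : ℝ) * ∑ e ∈ incidentEdges G v, relativeResistance G c e

/-- `G` is resistance nonnegative (RN). -/
def IsResistanceNonnegative : Prop :=
  ∃ c : G.edgeSet → ℝ, (∀ e, 0 < c e) ∧ ∀ v, 0 ≤ resistanceCurvature G c v

/-- The rank inequalities
`0 ≤ ∑_{e ∈ A} x_e ≤ |V| - #components of (V, A)` for all `A ⊆ E`. -/
def SatisfiesRankInequalities (x : G.edgeSet → ℝ) : Prop :=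
  ∀ A : Finset G.edgeSet,
    0 ≤ ∑ e ∈ A, x e ∧
    ∑ e ∈ A, x e ≤
      (Fintype.card V : ℝ) - (Nat.card (edgeSubgraph G A).ConnectedComponent : ℝ)

/-- The vertex inequalities of `2M(G)`. -/
def SatisfiesVertexInequalities (x : G.edgeSet → ℝ) : Prop :=
  ∀ v : V, ∑ e ∈ incidentEdges G v, x e ≤ 2

/-- The odd-set inequalities of `2M(G)`; `U.card / 2` is the rounded-down half. -/
def SatisfiesOddSetInequalities (x : G.edgeSet → ℝ) : Prop :=
  ∀ U : Finset V, Odd U.card →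
    ∑ e ∈ inducedEdges G U, x e ≤ 2 * ((U.card / 2 : ℕ) : ℝ)

end ResistanceGraph

end

/-!
The vector `r(c)` of relative resistances is the mean of the indicator vectors `e_T` when the
spanning tree `T` has probability proportional to `∏ t ∈ T, c t`. All these probabilities are
positive, so `r(c)` lies in the relative interior of `P(G)` (`sum_smul_mem_intrinsicInterior`).
Conversely, the means of an exponential family on finitely many points fill the relative interior
of their convex hull (`exists_exp_sum_smul_eq`), so every point of `P(G)°` is `r(c)` for some
positive `c`. Since `p_v(c) ≥ 0` is the vertex inequality `∑ e ∋ v, r_e(c) ≤ 2`, the graph is RN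
if and only if some point of `P(G)°` satisfies all vertex inequalities, and it remains to show
that on `P(G)` these inequalities describe `2M(G)`.

The rank inequalities hold on `P(G)` because a forest with edge set `F` has at most `|V| - |F|`
components (`card_add_card_connectedComponent_le`). Applied to `E(U)`, they give
`x(E(U)) ≤ |U| - 1` for every nonempty `U`, and this is the odd-set inequality if `|U|` is odd.

That the vertex and odd-set inequalities cut out `2M(G)` is Edmonds' theorem. It is proved here for
points that satisfy `x(E(U)) ≤ |U| - 1` for all nonempty `U`, odd or even, which saves a parity
argument. By separation it is enough to bound a nonnegative integral objective by its maximum over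
the matchings, and this bound (`exists_supportedInvolution_le`) follows by the induction of
Cunningham and Marsh on the total weight. If some vertex is covered by all maximum-weight
matchings, the weights at this vertex are lowered by one and the vertex inequality accounts for the
difference. Otherwise the weights inside a component `K` of the support are lowered by one and the
inequality for `K` accounts for the difference, because by Gallai's lemma
(`eq_of_fixed_of_gallaiKernel_max`) a suitable optimal matching misses at most one vertex of `K`.
Matchings are encoded as involutions of the vertex set, so that the alternating paths of two
matchings become orbits of the group that two involutions generate (`exists_invariant_finset`).
-/

noncomputable section

namespace ResistanceGraph

/-! ### Rank inequalities -/

section RankInequalities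

variable {V : Type*} (G : SimpleGraph V)

lemma edgeSubgraph_adj {A : Finset G.edgeSet} {u v : V} :
    (edgeSubgraph G A).Adj u v ↔ ∃ e ∈ A, (e : Sym2 V) = s(u, v) := by
  rw [edgeSubgraph, SimpleGraph.fromEdgeSet_adj]
  constructor
  · rintro ⟨⟨e, he, h⟩, -⟩
    exact ⟨e, he, h⟩
  · rintro ⟨e, he, h⟩
    have huv : G.Adj u v := by
      rw [← SimpleGraph.mem_edgeSet, ← h]
      exact e.2
    exact ⟨⟨e, he, h⟩, huv.ne⟩

lemma edgeSubgraph_mono {A B : Finset G.edgeSet} (h : A ⊆ B) :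
    edgeSubgraph G A ≤ edgeSubgraph G B := by
  intro u v
  simp only [edgeSubgraph_adj]
  rintro ⟨e, he, h'⟩
  exact ⟨e, h he, h'⟩

open Classical in
lemma sum_indicatorVector (A T : Finset G.edgeSet) :
    ∑ e ∈ A, indicatorVector G T e = ((T ∩ A).card : ℝ) := by
  simp only [indicatorVector]
  rw [Finset.sum_boole, Finset.filter_mem_eq_inter, Finset.inter_comm]

lemma convex_setOf_sum_le (A : Finset G.edgeSet) (b : ℝ) :
    Convex ℝ {x : G.edgeSet → ℝ | ∑ e ∈ A, x e ≤ b} := by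
  have := convex_halfSpace_le (𝕜 := ℝ) (f := fun x : G.edgeSet → ℝ => ∑ e ∈ A, x e)
    ⟨fun x y => by simp [Finset.sum_add_distrib], fun c x => by simp [Finset.mul_sum]⟩ b
  exact this

lemma convex_setOf_le_sum (A : Finset G.edgeSet) (b : ℝ) :
    Convex ℝ {x : G.edgeSet → ℝ | b ≤ ∑ e ∈ A, x e} := by
  have := convex_halfSpace_ge (𝕜 := ℝ) (f := fun x : G.edgeSet → ℝ => ∑ e ∈ A, x e)
    ⟨fun x y => by simp [Finset.sum_add_distrib], fun c x => by simp [Finset.mul_sum]⟩ b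
  exact this

variable [Fintype V]

/-- A forest with edge set `F` has at most `|V| - |F|` components: by induction on `F`, since
every edge of a forest is a bridge and so joins two components of the rest. -/
lemma card_add_card_connectedComponent_le (F : Finset G.edgeSet)
    (hF : (edgeSubgraph G F).IsAcyclic) :
    F.card + Nat.card (edgeSubgraph G F).ConnectedComponent ≤ Fintype.card V := by
  classical
  induction F using Finset.induction_on with
  | empty =>
    rw [Finset.card_empty, zero_add, ← Nat.card_eq_fintype_card]
    exact Nat.card_le_card_of_surjective (edgeSubgraph G ∅).connectedComponentMk
      Quot.mk_surjective
  | insert e F heF ih =>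
    have hle : edgeSubgraph G F ≤ edgeSubgraph G (insert e F) :=
      edgeSubgraph_mono G (Finset.subset_insert e F)
    have ih := ih (hF.anti hle)
    rw [Finset.card_insert_of_notMem heF]
    have hlt : Nat.card (edgeSubgraph G (insert e F)).ConnectedComponent <
        Nat.card (edgeSubgraph G F).ConnectedComponent := by
      refine lt_of_le_of_ne (SimpleGraph.ConnectedComponent.card_le_card_of_le hle) fun heq => ?_
      have hsurj := SimpleGraph.ConnectedComponent.surjective_map_ofLE hle
      have hbij := (Nat.bijective_iff_surjective_and_card _).2 ⟨hsurj, heq.symm⟩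
      obtain ⟨e, he⟩ := e
      induction e with | h u v =>
      have hadj : (edgeSubgraph G (insert ⟨s(u, v), he⟩ F)).Adj u v :=
        (edgeSubgraph_adj G).2 ⟨_, Finset.mem_insert_self _ _, rfl⟩
      have hbr := SimpleGraph.isAcyclic_iff_forall_isBridge.1 hF
        ((SimpleGraph.mem_edgeSet _).2 hadj)
      rw [SimpleGraph.isBridge_iff] at hbr
      refine hbr (SimpleGraph.Reachable.mono (G := edgeSubgraph G F) ?_ ?_)
      · intro a b hab
        rw [SimpleGraph.deleteEdges_adj]
        refine ⟨hle hab, fun h => ?_⟩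
        obtain ⟨f, hf, hfab⟩ := (edgeSubgraph_adj G).1 hab
        rw [Set.mem_singleton_iff, ← hfab] at h
        exact heF ((Subtype.ext h : f = ⟨s(u, v), he⟩) ▸ hf)
      · have := @hbij.1 ((edgeSubgraph G F).connectedComponentMk u)
          ((edgeSubgraph G F).connectedComponentMk v)
          (by simpa using hadj.reachable)
        exact SimpleGraph.ConnectedComponent.eq.1 this
    omega

theorem satisfiesRankInequalities_of_mem {x : G.edgeSet → ℝ} (hx : x ∈ spanningTreePolytope G) :
    SatisfiesRankInequalities G x := by
  classical
  intro A
  refine convexHull_min (t := {x : G.edgeSet → ℝ | 0 ≤ ∑ e ∈ A, x e} ∩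
    {x : G.edgeSet → ℝ | ∑ e ∈ A, x e ≤
      (Fintype.card V : ℝ) - (Nat.card (edgeSubgraph G A).ConnectedComponent : ℝ)}) ?_
    ((convex_setOf_le_sum G A 0).inter (convex_setOf_sum_le G A _)) hx
  rintro _ ⟨T, hT, rfl⟩
  simp only [Set.mem_inter_iff, Set.mem_ofPred_eq, sum_indicatorVector]
  refine ⟨Nat.cast_nonneg _, ?_⟩
  have h1 := card_add_card_connectedComponent_le G (T ∩ A)
    (hT.prop.anti (edgeSubgraph_mono G Finset.inter_subset_left))
  have h2 := SimpleGraph.ConnectedComponent.card_le_card_of_le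
    (edgeSubgraph_mono G (Finset.inter_subset_right : T ∩ A ⊆ A))
  rw [le_sub_iff_add_le]
  exact_mod_cast (Nat.add_le_add_left h2 _).trans h1

/-- In `(V, E(U))` the vertices outside `U` are isolated, which leaves at least
`|V| - |U| + 1` components. -/
lemma card_add_one_le_card_connectedComponent_inducedEdges_add (U : Finset V) (hU : U.Nonempty) :
    Fintype.card V + 1 ≤
      Nat.card (edgeSubgraph G (inducedEdges G U)).ConnectedComponent + U.card := by
  classical
  set H := edgeSubgraph G (inducedEdges G U) with hH
  obtain ⟨u, hu⟩ := hU
  have hiso : ∀ v ∉ U, ∀ w, H.Reachable v w → v = w := by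
    rintro v hv w ⟨p⟩
    cases p with
    | nil => rfl
    | cons h _ =>
      obtain ⟨e, he, hevw⟩ := (edgeSubgraph_adj G).1 h
      simp only [inducedEdges, Finset.mem_filter, Finset.mem_univ, true_and] at he
      exact absurd (he v (hevw ▸ Sym2.mem_mk_left _ _)) hv
  let f : Option {v // v ∉ U} → H.ConnectedComponent := fun o =>
    o.elim (H.connectedComponentMk u) fun v => H.connectedComponentMk v
  have hf : Function.Injective f := by
    rintro (_ | ⟨v, hv⟩) (_ | ⟨w, hw⟩) h
    · rfl
    · have := hiso w hw u (SimpleGraph.ConnectedComponent.eq.1 h).symm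
      exact absurd (this ▸ hu) hw
    · have := hiso v hv u (SimpleGraph.ConnectedComponent.eq.1 h)
      exact absurd (this ▸ hu) hv
    · have := hiso v hv w (SimpleGraph.ConnectedComponent.eq.1 h)
      simp [this]
  have h1 := Nat.card_le_card_of_injective f hf
  rw [Nat.card_eq_fintype_card, Fintype.card_option, Fintype.card_subtype_compl,
    Fintype.card_coe] at h1
  have := Finset.card_le_univ U
  omega

variable {G} in
/-- The rank inequality of `E(U)` bounds `x(E(U))` by `|U| - 1`, whatever the parity of `|U|`. -/
lemma SatisfiesRankInequalities.sum_inducedEdges_le {x : G.edgeSet → ℝ}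
    (hx : SatisfiesRankInequalities G x) {U : Finset V} (hU : U.Nonempty) :
    ∑ e ∈ inducedEdges G U, x e ≤ (U.card : ℝ) - 1 := by
  have h1 := (hx (inducedEdges G U)).2
  have h2 : ((Fintype.card V + 1 : ℕ) : ℝ) ≤ ((_ + U.card : ℕ) : ℝ) :=
    Nat.cast_le.2 (card_add_one_le_card_connectedComponent_inducedEdges_add G U hU)
  push_cast at h2
  linarith

variable {G} in
lemma SatisfiesRankInequalities.nonneg {x : G.edgeSet → ℝ}
    (hx : SatisfiesRankInequalities G x) (e : G.edgeSet) : 0 ≤ x e := by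
  simpa using (hx {e}).1

variable {G} in
theorem SatisfiesRankInequalities.satisfiesOddSetInequalities {x : G.edgeSet → ℝ}
    (hx : SatisfiesRankInequalities G x) : SatisfiesOddSetInequalities G x := by
  intro U hU
  refine (hx.sum_inducedEdges_le (Finset.card_pos.1 hU.pos)).trans ?_
  obtain ⟨k, hk⟩ := hU
  have : U.card / 2 = k := by omega
  rw [this, hk]
  push_cast
  linarith

end RankInequalities

/-! ### Maximum-weight matchings as involutions -/

section Involutions

variable {V : Type*}

/-- A matching inside the support of the weights `W`, encoded as the involution of the vertex
set that swaps the ends of its edges and fixes the uncovered vertices. -/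
structure IsSupportedInvolution (W : V → V → ℕ) (σ : V → V) : Prop where
  involutive : Function.Involutive σ
  pos : ∀ v, σ v ≠ v → 0 < W v (σ v)

lemma isSupportedInvolution_id (W : V → V → ℕ) : IsSupportedInvolution W id :=
  ⟨fun _ => rfl, fun _ h => absurd rfl h⟩

lemma IsSupportedInvolution.mono {W W' : V → V → ℕ} {σ : V → V} (hW : ∀ u v, W' u v ≤ W u v)
    (hσ : IsSupportedInvolution W' σ) : IsSupportedInvolution W σ :=
  ⟨hσ.involutive, fun v hv => (hσ.pos v hv).trans_le (hW _ _)⟩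

/-- Two matchings can be exchanged on a vertex set that both of them preserve. -/
lemma IsSupportedInvolution.piecewise [DecidableEq V] {W : V → V → ℕ} {M N : V → V}
    (hM : IsSupportedInvolution W M) (hN : IsSupportedInvolution W N) {C : Finset V}
    (hCM : ∀ a ∈ C, M a ∈ C) (hCN : ∀ a ∈ C, N a ∈ C) :
    IsSupportedInvolution W (C.piecewise N M) := by
  have hCM' : ∀ a ∉ C, M a ∉ C := fun a ha h => ha (hM.involutive a ▸ hCM _ h)
  constructor
  · intro a
    by_cases ha : a ∈ C
    · rw [C.piecewise_eq_of_mem _ _ ha, C.piecewise_eq_of_mem _ _ (hCN a ha), hN.involutive]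
    · rw [C.piecewise_eq_of_notMem _ _ ha, C.piecewise_eq_of_notMem _ _ (hCM' a ha),
        hM.involutive]
  · intro a
    by_cases ha : a ∈ C
    · rw [C.piecewise_eq_of_mem _ _ ha]
      exact hN.pos a
    · rw [C.piecewise_eq_of_notMem _ _ ha]
      exact hM.pos a

/-- Let `m`, `n` be involutions and let `n` fix `t`. The orbit of `t` under the group that they
generate contains at most one fixed point of `m`. In terms of matchings: the component of `t` in
the union of two matchings is a path that has `t` as one end.

The orbit is `{ρ ^ k t}` for `ρ = n * m`, and `m` fixes `ρ ^ a t` only if `ρ ^ (2a + 1)` fixes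
`t`. If this holds for `a` and `b`, then `ρ ^ (a - b)` fixes `t` as well. -/
lemma exists_invariant_finset [Fintype V] {m n : V → V} (hm : Function.Involutive m)
    (hn : Function.Involutive n) {t : V} (ht : n t = t) :
    ∃ C : Finset V, t ∈ C ∧ (∀ a ∈ C, m a ∈ C) ∧ (∀ a ∈ C, n a ∈ C) ∧
      ∀ a ∈ C, ∀ b ∈ C, m a = a → m b = b → a = b := by
  classical
  obtain ⟨ρ, hρ⟩ : ∃ ρ : Equiv.Perm V, ∀ a, ρ a = n (m a) :=
    ⟨hn.toPerm n * hm.toPerm m, fun _ => rfl⟩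
  have hρ' : ∀ a, ρ⁻¹ a = m (n a) := fun a => by
    rw [Equiv.Perm.inv_eq_iff_eq, hρ, hm, hn]
  have hconj : ∀ k : ℤ, ∀ a, n ((ρ ^ k) a) = (ρ ^ (-k)) (n a) := by
    intro k
    induction k with
    | zero => intro a; simp
    | succ k ih =>
      intro a
      rw [zpow_add_one, Equiv.Perm.mul_apply, ih, neg_add, ← sub_eq_add_neg, zpow_sub_one,
        Equiv.Perm.mul_apply, hρ', hρ, hn, hn]
    | pred k ih =>
      intro a
      rw [zpow_sub_one, Equiv.Perm.mul_apply, ih, neg_sub, sub_eq_add_neg, add_comm,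
        zpow_add_one, Equiv.Perm.mul_apply, hρ', hρ]
  have hnk : ∀ k : ℤ, n ((ρ ^ k) t) = (ρ ^ (-k)) t := fun k => by rw [hconj, ht]
  have hmk : ∀ k : ℤ, m ((ρ ^ k) t) = (ρ ^ (-(k + 1))) t := fun k => by
    rw [← hnk, add_comm, zpow_add, zpow_one, Equiv.Perm.mul_apply, hρ, hn]
  have hfix : ∀ k : ℤ, m ((ρ ^ k) t) = (ρ ^ k) t → (ρ ^ (2 * k + 1)) t = t := by
    intro k hk
    rw [hmk] at hk
    have := congrArg (ρ ^ (k + 1)) hk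
    rw [← Equiv.Perm.mul_apply, ← Equiv.Perm.mul_apply, ← zpow_add, ← zpow_add, add_neg_cancel,
      zpow_zero, Equiv.Perm.one_apply] at this
    rw [show 2 * k + 1 = k + 1 + k by ring, ← this]
  refine ⟨Finset.univ.filter fun a => ∃ k : ℤ, (ρ ^ k) t = a, ?_, ?_, ?_, ?_⟩
  · simp only [Finset.mem_filter, Finset.mem_univ, true_and]
    exact ⟨0, by simp⟩
  · simp only [Finset.mem_filter, Finset.mem_univ, true_and]
    rintro _ ⟨k, rfl⟩
    exact ⟨_, (hmk k).symm⟩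
  · simp only [Finset.mem_filter, Finset.mem_univ, true_and]
    rintro _ ⟨k, rfl⟩
    exact ⟨_, (hnk k).symm⟩
  · simp only [Finset.mem_filter, Finset.mem_univ, true_and]
    rintro _ ⟨a, rfl⟩ _ ⟨b, rfl⟩ ha hb
    let S := MulAction.stabilizer (Equiv.Perm V) t
    have ha' : ρ ^ (2 * a + 1) ∈ S := hfix a ha
    have hb' : ρ ^ (2 * b + 1) ∈ S := hfix b hb
    have hab : ρ ^ (a - b) ∈ S := by
      -- `a - b = (a - b) (2a + 1) - a ((2a + 1) - (2b + 1))`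
      have h1 := S.mul_mem (S.zpow_mem ha' (a - b))
        (S.zpow_mem (S.mul_mem ha' (S.inv_mem hb')) (-a))
      rw [← zpow_neg, ← zpow_add, ← zpow_mul, ← zpow_mul, ← zpow_add] at h1
      convert h1 using 2
      ring
    have h2 : (ρ ^ (a - b)) t = t := hab
    rw [show a = b + (a - b) by ring, zpow_add, Equiv.Perm.mul_apply, h2]

variable [Fintype V]

lemma sum_piecewise_add [DecidableEq V] {R : Type*} [AddCommMonoid R] (F : V → V → R)
    (M N : V → V) (C : Finset V) :
    ∑ a, F a (C.piecewise N M a) + ∑ a ∈ C, F a (M a) =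
      ∑ a, F a (M a) + ∑ a ∈ C, F a (N a) := by
  rw [← Finset.sum_add_sum_compl C fun a => F a (C.piecewise N M a),
    ← Finset.sum_add_sum_compl C fun a => F a (M a)]
  have h1 : ∑ a ∈ C, F a (C.piecewise N M a) = ∑ a ∈ C, F a (N a) :=
    Finset.sum_congr rfl fun a ha => by rw [C.piecewise_eq_of_mem _ _ ha]
  have h2 : ∑ a ∈ Cᶜ, F a (C.piecewise N M a) = ∑ a ∈ Cᶜ, F a (M a) :=
    Finset.sum_congr rfl fun a ha => by
      rw [C.piecewise_eq_of_notMem _ _ (Finset.mem_compl.1 ha)]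
  rw [h1, h2, add_comm (∑ a ∈ C, F a (N a)), add_assoc, add_assoc, add_left_comm, add_comm]
  abel

/-- `∑ v, W v (σ v)` counts the weight of each edge of the matching `σ` twice. -/
lemma even_sum_involution {W : V → V → ℕ} (hsymm : ∀ u v, W u v = W v u)
    (hdiag : ∀ v, W v v = 0) {σ : V → V} (hσ : Function.Involutive σ) :
    Even (∑ v, W v (σ v)) := by
  rw [← ZMod.natCast_eq_zero_iff_even, Nat.cast_sum]
  refine Finset.sum_involution (fun v _ => σ v) (fun v _ => ?_) (fun v _ h => ?_)
    (fun _ _ => Finset.mem_univ _) (fun v _ => hσ v)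
  · rw [hσ, hsymm (σ v)]
    exact CharTwo.add_self_eq_zero _
  · intro h'
    rw [h', hdiag] at h
    simp at h

lemma exists_max_supportedInvolution {R : Type*} [LinearOrder R] (W : V → V → ℕ)
    (f : (V → V) → R) :
    ∃ M, IsSupportedInvolution W M ∧ ∀ N, IsSupportedInvolution W N → f N ≤ f M := by
  have : Nonempty {σ : V → V // IsSupportedInvolution W σ} := ⟨⟨id, isSupportedInvolution_id W⟩⟩
  obtain ⟨M, hM⟩ := Finite.exists_max fun σ : {σ : V → V // IsSupportedInvolution W σ} => f σ
  exact ⟨M, M.2, fun N hN => hM ⟨N, hN⟩⟩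

open Classical in
/-- The kernel of the objective `(|V| + 1) W(σ) - |V| n(σ)`, with `n(σ)` the number of vertices
of `K` that `σ` covers. It lets one maximize `W(σ) - n(σ)` first and `n(σ)` next. -/
def gallaiKernel (W : V → V → ℕ) (K : Finset V) (a b : V) : ℤ :=
  (Fintype.card V + 1) * W a b - Fintype.card V * (if a ∈ K ∧ b ≠ a then 1 else 0)

/-- Gallai's lemma: if every vertex of the connected set `K` is missed by a maximum-weight
matching, then a matching that maximizes the `gallaiKernel` objective misses at most one vertex
of `K`. Being equal or not missed together by an optimal matching is a transitive relation. -/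
lemma eq_of_fixed_of_gallaiKernel_max {W : V → V → ℕ} (hsymm : ∀ u v, W u v = W v u)
    (hdiag : ∀ v, W v v = 0) {K : Finset V} {ν : ℕ}
    (hν : ∀ N, IsSupportedInvolution W N → ∑ a, W a (N a) ≤ ν)
    (hK : ∀ t ∈ K, ∃ N, IsSupportedInvolution W N ∧ ∑ a, W a (N a) = ν ∧ N t = t)
    (hclosed : ∀ a ∈ K, ∀ b, 0 < W a b → b ∈ K)
    {u v : V} (hu : u ∈ K) (huv : Relation.ReflTransGen (fun a b => 0 < W a b) u v)
    {M : V → V} (hM : IsSupportedInvolution W M)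
    (hmax : ∀ N, IsSupportedInvolution W N →
      ∑ a, gallaiKernel W K a (N a) ≤ ∑ a, gallaiKernel W K a (M a))
    (hMu : M u = u) (hMv : M v = v) : u = v := by
  classical
  have key : ∀ w, Relation.ReflTransGen (fun a b => 0 < W a b) u w → w ∈ K ∧
      ∀ M, IsSupportedInvolution W M → (∀ N, IsSupportedInvolution W N →
        ∑ a, gallaiKernel W K a (N a) ≤ ∑ a, gallaiKernel W K a (M a)) →
      M u = u → M w = w → u = w := by
    intro w hw
    induction hw with
    | refl => exact ⟨hu, fun _ _ _ _ _ => rfl⟩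
    | @tail t w _ htw ih =>
      obtain ⟨htK, ih⟩ := ih
      have hwK : w ∈ K := hclosed t htK w htw
      refine ⟨hwK, fun M hM hmax hMu hMw => ?_⟩
      -- Two adjacent vertices are not both missed: joining them would increase the objective.
      have hadj : ∀ M, IsSupportedInvolution W M → (∀ N, IsSupportedInvolution W N →
          ∑ a, gallaiKernel W K a (N a) ≤ ∑ a, gallaiKernel W K a (M a)) →
          M t = t → M w = w → t = w := by
        intro M hM hmax hMt hMw
        by_contra hne
        have hN : IsSupportedInvolution W (Equiv.swap t w) := by
          refine ⟨fun a => Equiv.swap_apply_self t w a, fun a ha => ?_⟩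
          by_cases hat : a = t
          · rw [hat, Equiv.swap_apply_left]
            exact htw
          by_cases haw : a = w
          · rw [haw, Equiv.swap_apply_right, hsymm]
            exact htw
          exact absurd (Equiv.swap_apply_of_ne_of_ne hat haw) ha
        have hlt := hmax _ (hM.piecewise hN (C := {t, w}) (by simp [hMt, hMw]) (by simp))
        have heq := sum_piecewise_add (gallaiKernel W K) M (Equiv.swap t w) {t, w}
        rw [Finset.sum_pair hne, Finset.sum_pair hne, Equiv.swap_apply_left,
          Equiv.swap_apply_right, hMt, hMw] at heq
        simp only [gallaiKernel, htK, hwK, ne_eq, not_true_eq_false, and_false, if_false,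
          hne, Ne.symm hne, not_false_eq_true, and_self, if_true, hsymm w t,
          hdiag, Nat.cast_zero, mul_zero, sub_zero, add_zero, mul_one] at heq hlt
        have h1 : ((Fintype.card V : ℤ) + 1) * 1 ≤ (Fintype.card V + 1) * W t w :=
          mul_le_mul_of_nonneg_left (by exact_mod_cast htw) (by positivity)
        linarith
      by_cases hMt : M t = t
      · rw [ih M hM hmax hMu hMt, hadj M hM hmax hMt hMw]
      by_contra hne
      obtain ⟨N, hN, hNν, hNt⟩ := hK t htK
      obtain ⟨C, htC, hCM, hCN, hCfix⟩ := exists_invariant_finset hM.involutive hN.involutive hNt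
      have hM' := hM.piecewise hN hCM hCN
      have hN' := hN.piecewise hM hCN hCM
      -- `C` is the alternating path from `t`. As `N` has maximum weight, the exchange on `C` does
      -- not decrease the weight of `M`; and `N` covers no more of `C ∩ K` than `M` does, since it
      -- misses `t`, while `M` misses at most one vertex of `C`.
      have hWle : ∑ a ∈ C, W a (M a) ≤ ∑ a ∈ C, W a (N a) := by
        have h1 := sum_piecewise_add W N M C
        have h2 := hν _ hN'
        omega
      have hcle : ((C.filter fun a => a ∈ K ∧ N a ≠ a).card) ≤
          (C.filter fun a => a ∈ K ∧ M a ≠ a).card := by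
        have h1 : (C.filter fun a => a ∈ K ∧ N a ≠ a) ⊆ (C.filter fun a => a ∈ K).erase t := by
          intro a
          simp only [Finset.mem_filter, Finset.mem_erase]
          rintro ⟨haC, haK, ha⟩
          exact ⟨fun h => ha (h ▸ hNt), haC, haK⟩
        have h2 := Finset.card_le_card h1
        have ht : t ∈ C.filter fun a => a ∈ K := Finset.mem_filter.2 ⟨htC, htK⟩
        have h5 := Finset.card_pos.2 ⟨t, ht⟩
        rw [Finset.card_erase_of_mem ht] at h2
        have h3 : (C.filter fun a => a ∈ K ∧ M a = a).card ≤ 1 := by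
          refine Finset.card_le_one.2 fun a ha b hb => ?_
          simp only [Finset.mem_filter] at ha hb
          exact hCfix a ha.1 b hb.1 ha.2.2 hb.2.2
        have h4 := Finset.card_filter_add_card_filter_not (s := C.filter fun a => a ∈ K)
          fun a => M a = a
        rw [Finset.filter_filter, Finset.filter_filter] at h4
        simp only [ne_eq] at h2 ⊢
        omega
      -- After the exchange on `C` the matching is still optimal and misses `t`.
      have hmax' : ∀ L, IsSupportedInvolution W L → ∑ a, gallaiKernel W K a (L a) ≤
          ∑ a, gallaiKernel W K a (C.piecewise N M a) := by
        intro L hL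
        refine (hmax L hL).trans ?_
        have h1 := sum_piecewise_add (gallaiKernel W K) M N C
        have h2 : ∀ L : V → V, ∑ a ∈ C, gallaiKernel W K a (L a) =
            (Fintype.card V + 1) * ((∑ a ∈ C, W a (L a) : ℕ) : ℤ) -
              Fintype.card V * ((C.filter fun a => a ∈ K ∧ L a ≠ a).card : ℤ) := by
          intro L
          simp only [gallaiKernel, Finset.sum_sub_distrib, ← Finset.mul_sum]
          rw [Finset.sum_boole, Nat.cast_sum]
        rw [h2, h2] at h1
        have h3 : ((Fintype.card V : ℤ) + 1) * ((∑ a ∈ C, W a (M a) : ℕ) : ℤ) ≤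
            (Fintype.card V + 1) * ((∑ a ∈ C, W a (N a) : ℕ) : ℤ) :=
          mul_le_mul_of_nonneg_left (by exact_mod_cast hWle) (by positivity)
        have h4 : (Fintype.card V : ℤ) * ((C.filter fun a => a ∈ K ∧ N a ≠ a).card : ℤ) ≤
            Fintype.card V * ((C.filter fun a => a ∈ K ∧ M a ≠ a).card : ℤ) :=
          mul_le_mul_of_nonneg_left (by exact_mod_cast hcle) (by positivity)
        linarith
      have hM't : C.piecewise N M t = t := by rw [C.piecewise_eq_of_mem _ _ htC, hNt]
      have htu : u ≠ t := fun h => hMt (h ▸ hMu)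
      have htw' : t ≠ w := fun h => hMt (h ▸ hMw)
      by_cases huC : u ∈ C
      · have hwC : w ∉ C := fun hwC => hne (hCfix u huC w hwC hMu hMw)
        exact htw' (hadj _ hM' hmax' hM't (by rw [C.piecewise_eq_of_notMem _ _ hwC, hMw]))
      · exact htu (ih _ hM' hmax' (by rw [C.piecewise_eq_of_notMem _ _ huC, hMu]) hM't)
  exact (key v huv).2 M hM hmax hMu hMv

/-- The Cunningham–Marsh induction on the total weight: the weight of a maximum-weight matching
bounds the value of the weights on every point `Y` that satisfies the vertex inequalities and
`Y(E(U)) ≤ (|U| - 1) / 2` for all nonempty `U`. Here `Y` is a symmetric matrix and both sides count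
every edge twice. If a vertex is covered by
all maximum-weight matchings, the weights at this vertex are decreased by one; otherwise the
weights within a component of the support are decreased by one, and Gallai's lemma applies. -/
theorem exists_supportedInvolution_le {Y : V → V → ℝ} (hY : ∀ u v, Y u v = Y v u)
    (hY0 : ∀ u v, 0 ≤ Y u v) (hrow : ∀ u, ∑ v, Y u v ≤ 1)
    (hU : ∀ U : Finset V, U.Nonempty → ∑ u ∈ U, ∑ v ∈ U, Y u v ≤ (U.card : ℝ) - 1)
    (W : V → V → ℕ) (hsymm : ∀ u v, W u v = W v u) (hdiag : ∀ v, W v v = 0) :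
    ∃ σ, IsSupportedInvolution W σ ∧
      ∑ u, ∑ v, (W u v : ℝ) * Y u v ≤ ((∑ v, W v (σ v) : ℕ) : ℝ) := by
  classical
  induction hn : ∑ u, ∑ v, W u v using Nat.strong_induction_on generalizing W with
  | _ n ih =>
  subst hn
  have hlt : ∀ W' : V → V → ℕ, (∀ u v, W' u v ≤ W u v) → ∀ a b, W' a b < W a b →
      ∑ u, ∑ v, W' u v < ∑ u, ∑ v, W u v := fun W' hle a b hab =>
    Finset.sum_lt_sum (fun u _ => Finset.sum_le_sum fun v _ => hle u v)
      ⟨a, Finset.mem_univ _, Finset.sum_lt_sum (fun v _ => hle a v) ⟨b, Finset.mem_univ _, hab⟩⟩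
  obtain ⟨M₀, hM₀, hmax₀⟩ := exists_max_supportedInvolution W fun σ => ∑ v, W v (σ v)
  set ν := ∑ v, W v (M₀ v) with hν
  by_cases hcase : ∃ u, ∀ σ, IsSupportedInvolution W σ → ∑ v, W v (σ v) = ν → σ u ≠ u
  · obtain ⟨u, hu⟩ := hcase
    let W' : V → V → ℕ := fun a b => if a = u ∨ b = u then W a b - 1 else W a b
    have hle : ∀ a b, W' a b ≤ W a b := fun a b => by
      simp only [W']; split_ifs <;> omega
    have hpos := hM₀.pos u (hu M₀ hM₀ rfl)
    obtain ⟨σ, hσ, hσY⟩ := ih _ (hlt W' hle u (M₀ u) (by simp [W', hpos])) W'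
      (fun a b => by simp only [W', or_comm, hsymm a b]) (fun a => by simp [W', hdiag]) rfl
    have hσW := hσ.mono hle
    have h1 : ∑ v, W' v (σ v) + 2 ≤ ν := by
      by_cases hσu : σ u = u
      · -- Both numbers are even.
        have h2 : ∑ v, W v (σ v) < ν :=
          lt_of_le_of_ne (hmax₀ σ hσW) fun h => hu σ hσW h hσu
        have h3 : ∑ v, W' v (σ v) ≤ ∑ v, W v (σ v) := Finset.sum_le_sum fun v _ => hle _ _
        obtain ⟨k, hk⟩ := even_sum_involution hsymm hdiag hM₀.involutive
        obtain ⟨l, hl⟩ := even_sum_involution hsymm hdiag hσ.involutive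
        omega
      · have h2 : ∑ v, (W' v (σ v) + ((if v = u then 1 else 0) + if v = σ u then 1 else 0)) ≤
            ∑ v, W v (σ v) := by
          refine Finset.sum_le_sum fun v _ => ?_
          have hiff : v = σ u ↔ σ v = u := by
            constructor
            · rintro rfl
              exact hσ.involutive u
            · rintro rfl
              exact (hσ.involutive v).symm
          by_cases hv : v = u
          · subst hv
            have := hσW.pos v hσu
            simp only [W', true_or, if_true, Ne.symm hσu, if_false]
            omega
          · by_cases hv' : σ v = u
            · have := hσW.pos v (by rw [hv']; exact Ne.symm hv)
              simp only [W', hv, hv', hiff, or_true, if_true, if_false]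
              rw [hv'] at this
              omega
            · simp [W', hv, hv', hiff]
        simp only [Finset.sum_add_distrib, Finset.sum_ite_eq', Finset.mem_univ, if_true] at h2
        have := hmax₀ σ hσW
        omega
    refine ⟨M₀, hM₀, ?_⟩
    have h2 : ∑ a, ∑ b, (W a b : ℝ) * Y a b ≤ ∑ a, ∑ b, ((W' a b : ℝ) * Y a b +
        ((if a = u then Y a b else 0) + if b = u then Y a b else 0)) := by
      refine Finset.sum_le_sum fun a _ => Finset.sum_le_sum fun b _ => ?_
      have hab := hY0 a b
      have h3 : (W a b : ℝ) ≤ W' a b + ((if a = u then 1 else 0) + if b = u then 1 else 0) := by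
        have : W a b ≤ W' a b + ((if a = u then 1 else 0) + if b = u then 1 else 0) := by
          simp only [W']
          by_cases ha : a = u <;> by_cases hb : b = u <;> simp [ha, hb] <;> omega
        exact_mod_cast this
      refine (mul_le_mul_of_nonneg_right h3 hab).trans (le_of_eq ?_)
      rw [add_mul, add_mul, ite_mul, ite_mul, one_mul, zero_mul]
    simp only [Finset.sum_add_distrib, Finset.sum_ite_eq', Finset.mem_univ, if_true] at h2
    have h3 : ∑ a, ∑ b, (if a = u then Y a b else 0) = ∑ b, Y u b := by
      rw [Finset.sum_comm]
      simp
    have h4 : ∑ a, Y a u = ∑ b, Y u b := Finset.sum_congr rfl fun a _ => hY a u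
    have h5 := hrow u
    have h6 : ((∑ v, W' v (σ v) : ℕ) : ℝ) + 2 ≤ ν := by exact_mod_cast h1
    rw [h3, h4] at h2
    rw [← hν]
    linarith
  · push Not at hcase
    by_cases hW : ∀ a b, W a b = 0
    · refine ⟨id, isSupportedInvolution_id W, ?_⟩
      simp [hW]
    push Not at hW
    obtain ⟨a₀, b₀, hab₀⟩ := hW
    let r : V → V → Prop := fun a b => 0 < W a b
    have : Std.Symm r := ⟨fun a b (h : 0 < W a b) => (hsymm a b ▸ h : 0 < W b a)⟩
    have hrsymm : ∀ a b, Relation.ReflTransGen r a b → Relation.ReflTransGen r b a :=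
      Relation.ReflTransGen.stdSymm.symm
    let K : Finset V := Finset.univ.filter fun v => Relation.ReflTransGen r a₀ v
    have hKmem : ∀ v, v ∈ K ↔ Relation.ReflTransGen r a₀ v := fun v => by simp [K]
    have ha₀ : a₀ ∈ K := (hKmem _).2 Relation.ReflTransGen.refl
    have hclosed : ∀ a ∈ K, ∀ b, 0 < W a b → b ∈ K := fun a ha b hab =>
      (hKmem _).2 (((hKmem _).1 ha).tail hab)
    have hb₀ : b₀ ∈ K := hclosed a₀ ha₀ b₀ (Nat.pos_of_ne_zero hab₀)
    let W' : V → V → ℕ := fun a b => if a ∈ K ∧ b ∈ K then W a b - 1 else W a b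
    have hle : ∀ a b, W' a b ≤ W a b := fun a b => by
      simp only [W']; split_ifs <;> omega
    obtain ⟨σ, hσ, hσY⟩ := ih _ (hlt W' hle a₀ b₀ (by simp [W', ha₀, hb₀]; omega)) W'
      (fun a b => by simp only [W', and_comm, hsymm a b]) (fun a => by simp [W', hdiag]) rfl
    obtain ⟨M, hM, hmax⟩ :=
      exists_max_supportedInvolution W fun σ => ∑ a, gallaiKernel W K a (σ a)
    have hfix : (K.filter fun a => M a = a).card ≤ 1 := by
      refine Finset.card_le_one.2 fun u hu v hv => ?_
      rw [Finset.mem_filter] at hu hv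
      exact eq_of_fixed_of_gallaiKernel_max hsymm hdiag hmax₀
        (fun t _ => hcase t) hclosed hu.1
        ((hrsymm _ _ ((hKmem u).1 hu.1)).trans ((hKmem v).1 hv.1)) hM hmax hu.2 hv.2
    have hcount := Finset.card_filter_add_card_filter_not (s := K) fun a => M a = a
    have hcov : ∀ τ : V → V, (K.filter fun a => ¬ τ a = a) =
        Finset.univ.filter fun a => a ∈ K ∧ ¬ τ a = a := fun τ => by ext; simp
    have hsplit : ∀ τ, IsSupportedInvolution W τ →
        ∑ a, W a (τ a) = ∑ a, W' a (τ a) + (K.filter fun a => ¬ τ a = a).card := by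
      intro τ hτ
      rw [hcov, Finset.card_filter, ← Finset.sum_add_distrib]
      refine Finset.sum_congr rfl fun a _ => ?_
      by_cases hτa : τ a = a
      · simp [hτa, W', hdiag]
      · have hpos := hτ.pos a hτa
        by_cases ha : a ∈ K
        · have hτaK := hclosed a ha _ hpos
          simp only [W', ha, hτaK, hτa, and_self, not_false_eq_true, if_true]
          omega
        · simp [W', ha]
    -- The objective is lexicographic in the value of `W'` and the number of covered vertices.
    have hsplit' : ∀ τ, IsSupportedInvolution W τ → ∑ a, gallaiKernel W K a (τ a) =
        (Fintype.card V + 1) * ((∑ a, W' a (τ a) : ℕ) : ℤ) +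
          (K.filter fun a => ¬ τ a = a).card := by
      intro τ hτ
      simp only [gallaiKernel, Finset.sum_sub_distrib, ← Finset.mul_sum, Finset.sum_boole]
      have h := hsplit τ hτ
      rw [hcov] at h ⊢
      rw [← Nat.cast_sum, h]
      push_cast
      ring
    have hcardK : (K.filter fun a => ¬ M a = a).card ≤ Fintype.card V := Finset.card_le_univ _
    have h1 : ∑ a, W' a (σ a) ≤ ∑ a, W' a (M a) := by
      have := hmax σ (hσ.mono hle)
      simp only [hsplit' σ (hσ.mono hle), hsplit' M hM] at this
      by_contra! hlt'
      have h2 : ((Fintype.card V : ℤ) + 1) * (((∑ a, W' a (M a) : ℕ) : ℤ) + 1) ≤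
          (Fintype.card V + 1) * ((∑ a, W' a (σ a) : ℕ) : ℤ) :=
        mul_le_mul_of_nonneg_left (by exact_mod_cast hlt') (by positivity)
      have h3 : ((K.filter fun a => ¬ M a = a).card : ℤ) ≤ Fintype.card V := by
        exact_mod_cast hcardK
      have h4 : (0 : ℤ) ≤ (K.filter fun a => ¬ σ a = a).card := by positivity
      linarith
    refine ⟨M, hM, ?_⟩
    have h2 : ∑ a, ∑ b, (W a b : ℝ) * Y a b ≤ ∑ a, ∑ b, ((W' a b : ℝ) * Y a b +
        if a ∈ K then if b ∈ K then Y a b else 0 else 0) := by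
      refine Finset.sum_le_sum fun a _ => Finset.sum_le_sum fun b _ => ?_
      have hab := hY0 a b
      have h3 : (W a b : ℝ) ≤ W' a b + (if a ∈ K then if b ∈ K then 1 else 0 else 0) := by
        have : W a b ≤ W' a b + (if a ∈ K then if b ∈ K then 1 else 0 else 0) := by
          simp only [W']
          by_cases ha : a ∈ K <;> by_cases hb : b ∈ K <;> simp [ha, hb]; omega
        exact_mod_cast this
      refine (mul_le_mul_of_nonneg_right h3 hab).trans (le_of_eq ?_)
      rw [add_mul, ite_mul, ite_mul, one_mul, zero_mul]
    have h3 : ∑ a, ∑ b, (if a ∈ K then if b ∈ K then Y a b else 0 else 0) =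
        ∑ a ∈ K, ∑ b ∈ K, Y a b := by
      have h4 : ∀ a, ∑ b, (if a ∈ K then if b ∈ K then Y a b else 0 else 0) =
          if a ∈ K then ∑ b ∈ K, Y a b else 0 := fun a => by split_ifs <;> simp
      simp [h4]
    simp only [Finset.sum_add_distrib] at h2
    have h4 := hU K ⟨a₀, ha₀⟩
    have h5 : ((∑ a, W' a (σ a) : ℕ) : ℝ) ≤ ((∑ a, W' a (M a) : ℕ) : ℝ) := by exact_mod_cast h1
    have h6 : (K.card : ℝ) ≤ 1 + (K.filter fun a => ¬ M a = a).card := by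
      have : K.card ≤ 1 + (K.filter fun a => ¬ M a = a).card := by omega
      exact_mod_cast this
    rw [hsplit M hM, Nat.cast_add]
    linarith

end Involutions

/-! ### The matching polytope -/

section MatchingPolytope

variable {V : Type*} [Fintype V] (G : SimpleGraph V)

open Classical in
/-- The symmetric function on pairs of vertices that extends `z` by zero off the edges. -/
def pairExtension {R : Type*} [AddCommMonoid R] (z : G.edgeSet → R) (u v : V) : R :=
  ∑ e : G.edgeSet, if (e : Sym2 V) = s(u, v) then z e else 0

section

variable {R : Type*} [AddCommMonoid R] (z : G.edgeSet → R)

lemma pairExtension_comm (u v : V) : pairExtension G z u v = pairExtension G z v u := by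
  rw [pairExtension, pairExtension, Sym2.eq_swap]

lemma pairExtension_coe (e : G.edgeSet) {u v : V} (h : (e : Sym2 V) = s(u, v)) :
    pairExtension G z u v = z e := by
  classical
  rw [pairExtension, Finset.sum_eq_single e]
  · rw [if_pos h]
  · intro f _ hf
    rw [if_neg fun h' => hf (Subtype.ext (h'.trans h.symm))]
  · intro h
    exact absurd (Finset.mem_univ e) h

lemma pairExtension_of_not_adj {u v : V} (h : ¬ G.Adj u v) : pairExtension G z u v = 0 := by
  classical
  refine Finset.sum_eq_zero fun e _ => if_neg fun he => h ?_
  rw [← SimpleGraph.mem_edgeSet, ← he]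
  exact e.2

lemma sum_pairExtension_right (u : V) :
    ∑ v, pairExtension G z u v = ∑ e ∈ incidentEdges G u, z e := by
  classical
  simp only [pairExtension, incidentEdges]
  rw [Finset.sum_comm, Finset.sum_filter]
  refine Finset.sum_congr rfl fun e _ => ?_
  split_ifs with h
  · obtain ⟨w, hw⟩ := h
    rw [Finset.sum_eq_single w]
    · rw [if_pos hw]
    · intro v _ hv
      rw [if_neg fun h' => hv (Sym2.congr_right.1 (h'.symm.trans hw))]
    · intro h
      exact absurd (Finset.mem_univ w) h
  · exact Finset.sum_eq_zero fun v _ => if_neg fun he : (e : Sym2 V) = s(u, v) =>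
      h (he ▸ Sym2.mem_mk_left _ _)

open Classical in
lemma sum_ite_mem_edge (e : G.edgeSet) (r : R) :
    ∑ v, (if v ∈ (e : Sym2 V) then r else 0) = 2 • r := by
  obtain ⟨e, he⟩ := e
  induction e with | h a b =>
  have hab : a ≠ b := G.ne_of_adj he
  rw [← Finset.sum_filter, Finset.sum_const]
  have : (Finset.univ.filter fun v => v ∈ s(a, b)) = {a, b} := by ext; simp
  rw [this, Finset.card_pair hab]

open Classical in
lemma sum_sum_pairExtension : ∑ u, ∑ v, pairExtension G z u v = 2 • ∑ e, z e := by
  classical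
  simp only [sum_pairExtension_right, incidentEdges, Finset.sum_filter]
  rw [Finset.sum_comm, Finset.smul_sum]
  exact Finset.sum_congr rfl fun e _ => sum_ite_mem_edge G e (z e)

lemma sum_sum_pairExtension_inducedEdges (U : Finset V) :
    ∑ u ∈ U, ∑ v ∈ U, pairExtension G z u v = 2 • ∑ e ∈ inducedEdges G U, z e := by
  classical
  rw [inducedEdges, Finset.sum_filter, ← sum_sum_pairExtension]
  have h : ∀ u v, pairExtension G
      (fun e => if ∀ v ∈ (e : Sym2 V), v ∈ U then z e else 0) u v =
      if u ∈ U then if v ∈ U then pairExtension G z u v else 0 else 0 := by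
    intro u v
    by_cases huv : G.Adj u v
    · rw [pairExtension_coe G _ ⟨s(u, v), huv⟩ rfl, pairExtension_coe G z ⟨s(u, v), huv⟩ rfl,
        ← ite_and]
      simp
    · rw [pairExtension_of_not_adj G _ huv, pairExtension_of_not_adj G _ huv]
      simp
  simp only [h]
  have h' : ∀ a, ∑ b, (if a ∈ U then if b ∈ U then pairExtension G z a b else 0 else 0) =
      if a ∈ U then ∑ b ∈ U, pairExtension G z a b else 0 := fun a => by split_ifs <;> simp
  simp [h']

end

open Classical in
/-- A point that satisfies the inequalities of `2M(G)` does not exceed the maximum of a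
nonnegative integral objective over the doubled matchings. -/
lemma exists_isMatchingSet_sum_mul_le {x : G.edgeSet → ℝ} (hx : SatisfiesRankInequalities G x)
    (hv : SatisfiesVertexInequalities G x) (w : G.edgeSet → ℕ) :
    ∃ M : Finset G.edgeSet, IsMatchingSet G M ∧ (∀ e ∈ M, 0 < w e) ∧
      ∑ e, (w e : ℝ) * x e ≤ 2 * ∑ e ∈ M, (w e : ℝ) := by
  classical
  have hY0 : ∀ u v, 0 ≤ pairExtension G x u v / 2 := fun u v =>
    div_nonneg (Finset.sum_nonneg fun e _ => by split_ifs; exacts [hx.nonneg e, le_rfl])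
      zero_le_two
  obtain ⟨σ, hσ, hle⟩ := exists_supportedInvolution_le
    (Y := fun u v => pairExtension G x u v / 2)
    (fun u v => by simp only [pairExtension_comm G x u v]) hY0
    (fun u => by
      rw [← Finset.sum_div, sum_pairExtension_right]
      linarith [hv u])
    (fun U hU => by
      simp only [← Finset.sum_div]
      rw [sum_sum_pairExtension_inducedEdges]
      have := hx.sum_inducedEdges_le hU
      rw [nsmul_eq_mul]
      push_cast
      linarith)
    (pairExtension G w) (pairExtension_comm G w)
    (fun v => pairExtension_of_not_adj G w G.irrefl)
  let M : Finset G.edgeSet := Finset.univ.filter fun e => ∃ u, (e : Sym2 V) = s(u, σ u)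
  have hM : ∀ e ∈ M, ∀ v ∈ (e : Sym2 V), (e : Sym2 V) = s(v, σ v) := by
    intro e he v hv
    obtain ⟨u, hu⟩ := (Finset.mem_filter.1 he).2
    rw [hu, Sym2.mem_iff] at hv
    rcases hv with rfl | rfl
    · exact hu
    · rw [hσ.involutive, hu, Sym2.eq_swap]
  refine ⟨M, ?_, ?_, ?_⟩
  · intro v e he f hf hve hvf
    exact Subtype.ext ((hM e he v hve).trans (hM f hf v hvf).symm)
  · intro e he
    obtain ⟨u, hu⟩ := (Finset.mem_filter.1 he).2
    have hne : σ u ≠ u := fun h => by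
      have hadj : G.Adj u (σ u) := by
        rw [← SimpleGraph.mem_edgeSet, ← hu]
        exact e.2
      exact hadj.ne h.symm
    have := hσ.pos u hne
    rwa [pairExtension_coe G w e hu] at this
  · have h1 : ∑ u, ∑ v, ((pairExtension G w u v : ℕ) : ℝ) * (pairExtension G x u v / 2) =
        ∑ e, (w e : ℝ) * x e := by
      have h2 : ∀ u v, ((pairExtension G w u v : ℕ) : ℝ) * (pairExtension G x u v / 2) =
          pairExtension G (fun e => (w e : ℝ) * x e) u v / 2 := by
        intro u v
        by_cases huv : G.Adj u v
        · simp only [pairExtension_coe G _ ⟨s(u, v), huv⟩ rfl]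
          ring
        · simp [pairExtension_of_not_adj G _ huv]
      simp only [h2, ← Finset.sum_div]
      rw [sum_sum_pairExtension, nsmul_eq_mul]
      push_cast
      ring
    have h2 : ∑ v, pairExtension G w v (σ v) = 2 • ∑ e ∈ M, w e := by
      simp only [pairExtension]
      rw [Finset.sum_comm, Finset.sum_filter, Finset.smul_sum]
      refine Finset.sum_congr rfl fun e _ => ?_
      by_cases he : ∃ u, (e : Sym2 V) = s(u, σ u)
      · rw [if_pos he, ← sum_ite_mem_edge G e (w e)]
        refine Finset.sum_congr rfl fun v _ => if_congr ⟨fun h => ?_, fun h => ?_⟩ rfl rfl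
        · rw [h]
          exact Sym2.mem_mk_left _ _
        · exact hM e (Finset.mem_filter.2 ⟨Finset.mem_univ _, he⟩) v h
      · rw [if_neg he, smul_zero]
        exact Finset.sum_eq_zero fun v _ => if_neg fun h => he ⟨v, h⟩
    rw [h1, h2, nsmul_eq_mul] at hle
    push_cast at hle
    exact hle

/-- Edmonds' description of the matching polytope, for points that satisfy the rank inequalities.
A functional that separates `x / 2` from the matchings is approximated by an integral one. -/
theorem mem_doubleMatchingPolytope_of_inequalities {x : G.edgeSet → ℝ}
    (hx : SatisfiesRankInequalities G x) (hv : SatisfiesVertexInequalities G x) :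
    x ∈ doubleMatchingPolytope G := by
  classical
  rw [doubleMatchingPolytope, Set.mem_smul_set_iff_inv_smul_mem₀ two_ne_zero]
  by_contra hnot
  have hfin : {x | ∃ M : Finset G.edgeSet, IsMatchingSet G M ∧ x = indicatorVector G M}.Finite :=
    (Set.finite_range (indicatorVector G)).subset (by
      rintro _ ⟨M, -, rfl⟩
      exact ⟨M, rfl⟩)
  obtain ⟨f, a, hf, ha⟩ := geometric_hahn_banach_closed_point (convex_convexHull ℝ _)
    (hfin.isClosed_convexHull ℝ) hnot
  let g : G.edgeSet → ℝ := fun e => f (Pi.single e 1)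
  have hfg : ∀ z, f z = ∑ e, z e * g e := by
    intro z
    have h := LinearMap.pi_apply_eq_sum_univ (f : (G.edgeSet → ℝ) →ₗ[ℝ] ℝ) z
    simp only [ContinuousLinearMap.coe_coe, smul_eq_mul] at h
    rw [h]
    refine Finset.sum_congr rfl fun e _ => ?_
    congr 2
    ext j
    simp [Pi.single_apply, eq_comm]
  -- Rounding `n g` down costs at most `∑ e, x e`, whereas the gap between `x` and the doubled
  -- matchings grows with `n`. Negative coefficients are rounded to zero.
  obtain ⟨n, hn⟩ := exists_nat_gt ((∑ e, x e) / (2 * (f ((2 : ℝ)⁻¹ • x) - a)))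
  rw [div_lt_iff₀ (by linarith)] at hn
  obtain ⟨M, hM, hpos, hle⟩ := exists_isMatchingSet_sum_mul_le G hx hv fun e => ⌊n * g e⌋₊
  have h1 : ∑ e ∈ M, ((⌊n * g e⌋₊ : ℕ) : ℝ) ≤ n * f (indicatorVector G M) := by
    rw [hfg, Finset.mul_sum]
    simp only [indicatorVector, ite_mul, one_mul, zero_mul, mul_ite, mul_zero]
    rw [Finset.sum_ite_mem, Finset.univ_inter]
    exact Finset.sum_le_sum fun e he =>
      Nat.floor_le ((Nat.pos_of_floor_pos (hpos e he)).le)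
  have h2 : f (indicatorVector G M) < a := hf _ (subset_convexHull ℝ _ ⟨M, hM, rfl⟩)
  have h3 : n * (2 * f ((2 : ℝ)⁻¹ • x)) ≤ ∑ e, ((⌊n * g e⌋₊ : ℕ) : ℝ) * x e + ∑ e, x e := by
    rw [hfg, Finset.mul_sum, Finset.mul_sum, ← Finset.sum_add_distrib]
    refine Finset.sum_le_sum fun e _ => ?_
    have h4 := mul_le_mul_of_nonneg_right (Nat.lt_floor_add_one (n * g e)).le (hx.nonneg e)
    simp only [Pi.smul_apply, smul_eq_mul]
    linarith
  have h4 : (n : ℝ) * f (indicatorVector G M) ≤ n * a :=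
    mul_le_mul_of_nonneg_left h2.le (Nat.cast_nonneg n)
  linarith

lemma satisfiesVertexInequalities_of_mem {x : G.edgeSet → ℝ} (hx : x ∈ doubleMatchingPolytope G) :
    SatisfiesVertexInequalities G x := by
  classical
  intro v
  obtain ⟨y, hy, rfl⟩ := hx
  have h : y ∈ {x : G.edgeSet → ℝ | ∑ e ∈ incidentEdges G v, x e ≤ 1} := by
    refine convexHull_min ?_ (convex_setOf_sum_le G _ _) hy
    rintro _ ⟨M, hM, rfl⟩
    have hcard : (M ∩ incidentEdges G v).card ≤ 1 := by
      refine Finset.card_le_one.2 fun e he f hf => ?_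
      simp only [incidentEdges, Finset.mem_inter, Finset.mem_filter, Finset.mem_univ,
        true_and] at he hf
      exact hM v e he.1 f hf.1 he.2 hf.2
    simp only [Set.mem_ofPred_eq, sum_indicatorVector]
    exact_mod_cast hcard
  simp only [Set.mem_ofPred_eq] at h
  simp only [Pi.smul_apply, smul_eq_mul, ← Finset.mul_sum]
  linarith

end MatchingPolytope

/-! ### Relative interiors and exponential families -/

section ExponentialFamily

lemma mem_intrinsicInterior_iff_exists_dist_lt {E : Type*} [NormedAddCommGroup E]
    [NormedSpace ℝ E] {S : Set E} {x : E} :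
    x ∈ intrinsicInterior ℝ S ↔ x ∈ affineSpan ℝ S ∧
      ∃ ε > 0, ∀ z ∈ affineSpan ℝ S, dist z x < ε → z ∈ S := by
  rw [mem_intrinsicInterior]
  constructor
  · rintro ⟨y, hy, rfl⟩
    rw [mem_interior_iff_mem_nhds, Metric.mem_nhds_iff] at hy
    obtain ⟨ε, hε, h⟩ := hy
    exact ⟨y.2, ε, hε, fun z hz hzy => @h ⟨z, hz⟩ hzy⟩
  · rintro ⟨hx, ε, hε, h⟩
    refine ⟨⟨x, hx⟩, ?_, rfl⟩
    rw [mem_interior_iff_mem_nhds, Metric.mem_nhds_iff]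
    exact ⟨ε, hε, fun z hz => h z z.2 hz⟩

variable {ι : Type*} [Fintype ι]

/-- A convex combination of finitely many points in which all weights are positive lies in the
relative interior of their convex hull: it divides the segment from some relative interior point
to some point of the hull. -/
lemma sum_smul_mem_intrinsicInterior {E : Type*} [NormedAddCommGroup E] [NormedSpace ℝ E]
    [FiniteDimensional ℝ E] [Nonempty ι] (p : ι → E) {w : ι → ℝ} (hw : ∀ i, 0 < w i)
    (hsum : ∑ i, w i = 1) :
    ∑ i, w i • p i ∈ intrinsicInterior ℝ (convexHull ℝ (Set.range p)) := by
  set S := convexHull ℝ (Set.range p) with hS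
  have hconv : Convex ℝ S := convex_convexHull ℝ _
  have hmem : ∀ v : ι → ℝ, (∀ i, 0 ≤ v i) → ∑ i, v i = 1 → ∑ i, v i • p i ∈ S :=
    fun v hv hv1 => hconv.sum_mem (fun i _ => hv i) hv1
      fun i _ => subset_convexHull ℝ _ (Set.mem_range_self i)
  set x := ∑ i, w i • p i with hx
  have hxS : x ∈ S := hmem w (fun i => (hw i).le) hsum
  obtain ⟨y, hy⟩ := Set.Nonempty.intrinsicInterior hconv ⟨x, hxS⟩
  obtain ⟨μ, hμ, hμ1, hμy⟩ : ∃ μ : ι → ℝ, (∀ i, 0 ≤ μ i) ∧ ∑ i, μ i = 1 ∧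
      ∑ i, μ i • p i = y := by
    have hsub : S ⊆ Fintype.linearCombination ℝ p '' stdSimplex ℝ ι := by
      refine convexHull_min ?_ ((convex_stdSimplex ℝ ι).linear_image _)
      rintro _ ⟨i, rfl⟩
      classical
      exact ⟨Pi.single i 1, single_mem_stdSimplex ℝ i, by simp⟩
    obtain ⟨μ, hμ, h⟩ := hsub (intrinsicInterior_subset hy)
    exact ⟨μ, hμ.1, hμ.2, h⟩
  obtain ⟨hyS, ε, hε, hball⟩ := mem_intrinsicInterior_iff_exists_dist_lt.1 hy
  obtain ⟨j, hj⟩ := Finite.exists_min w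
  have hle1 : ∀ (v : ι → ℝ), (∀ i, 0 ≤ v i) → ∑ i, v i = 1 → ∀ i, v i ≤ 1 :=
    fun v hv hv1 i => hv1 ▸ Finset.single_le_sum (fun k _ => hv k) (Finset.mem_univ i)
  -- With `t < 1` and `t ≤ w i` for all `i`, the vector `w - t μ` is nonnegative.
  set t := w j / 2 with ht
  have ht0 : 0 < t := half_pos (hw j)
  have ht1 : t < 1 := by
    have := hle1 w (fun i => (hw i).le) hsum j
    linarith
  have ht1' : 0 < 1 - t := by linarith
  have hz : ∑ i, ((w i - t * μ i) / (1 - t)) • p i ∈ S := by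
    refine hmem _ (fun i => div_nonneg ?_ ht1'.le) ?_
    · have h1 := hle1 μ hμ hμ1 i
      have h2 := mul_le_mul_of_nonneg_left h1 ht0.le
      have h3 := hj i
      linarith [hw j]
    · rw [← Finset.sum_div, Finset.sum_sub_distrib, ← Finset.mul_sum, hsum, hμ1, mul_one,
        div_self ht1'.ne']
  set z := ∑ i, ((w i - t * μ i) / (1 - t)) • p i with hzdef
  have hxz : x = t • y + (1 - t) • z := by
    rw [hzdef, ← hμy, Finset.smul_sum, Finset.smul_sum, ← Finset.sum_add_distrib]
    refine Finset.sum_congr rfl fun i _ => ?_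
    rw [smul_smul, smul_smul, mul_div_cancel₀ _ ht1'.ne', ← add_smul]
    congr 1
    ring
  refine mem_intrinsicInterior_iff_exists_dist_lt.2
    ⟨subset_affineSpan ℝ _ hxS, t * ε, mul_pos ht0 hε, fun q hq hqx => ?_⟩
  have hr : t⁻¹ • (q - x) + y ∈ S := by
    refine hball _ ?_ ?_
    · exact AffineSubspace.smul_vsub_vadd_mem _ t⁻¹ hq (subset_affineSpan ℝ _ hxS) hyS
    · rw [dist_eq_norm] at hqx ⊢
      rw [add_sub_cancel_right, norm_smul, norm_inv, Real.norm_of_nonneg ht0.le,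
        inv_mul_lt_iff₀ ht0]
      exact hqx
  have := hconv hr hz ht0.le ht1'.le (by ring)
  rw [smul_add, smul_smul, mul_inv_cancel₀ ht0.ne', one_smul, add_assoc, ← hxz,
    sub_add_cancel] at this
  exact this

variable {κ : Type*} [Fintype κ]

lemma norm_sq_le_dotProduct_self (θ : κ → ℝ) : ‖θ‖ ^ 2 ≤ θ ⬝ᵥ θ := by
  have h : ‖θ‖ ≤ Real.sqrt (θ ⬝ᵥ θ) := by
    refine (pi_norm_le_iff_of_nonneg (Real.sqrt_nonneg _)).2 fun i => ?_
    refine Real.abs_le_sqrt ?_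
    rw [sq]
    exact Finset.single_le_sum (f := fun i => θ i * θ i) (fun k _ => mul_self_nonneg _)
      (Finset.mem_univ i)
  have h0 : 0 ≤ θ ⬝ᵥ θ := Finset.sum_nonneg fun k _ => mul_self_nonneg (θ k)
  calc ‖θ‖ ^ 2 ≤ Real.sqrt (θ ⬝ᵥ θ) ^ 2 := pow_le_pow_left₀ (norm_nonneg _) h 2
    _ = θ ⬝ᵥ θ := Real.sq_sqrt h0

/-- Every point `x` of the relative interior is the mean of an exponential family on the given
points. The function `θ ↦ ∑ i, exp (θ ⬝ (p i - x))` is coercive on the direction `D` of the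
affine span, because a small step from `x` in the direction `θ` stays in the convex hull; hence it
has a minimum on `D`, and the gradient there vanishes, since it lies in `D`. -/
lemma exists_exp_sum_smul_eq (p : ι → κ → ℝ) {x : κ → ℝ}
    (hx : x ∈ intrinsicInterior ℝ (convexHull ℝ (Set.range p))) :
    ∃ θ : κ → ℝ, ∑ i, Real.exp (θ ⬝ᵥ p i) • p i = (∑ i, Real.exp (θ ⬝ᵥ p i)) • x := by
  obtain ⟨hxs, ε, hε, hball⟩ := mem_intrinsicInterior_iff_exists_dist_lt.1 hx
  set A := affineSpan ℝ (convexHull ℝ (Set.range p)) with hA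
  let D : Submodule ℝ (κ → ℝ) := A.direction
  have hpD : ∀ i, p i - x ∈ D := fun i => AffineSubspace.vsub_mem_direction
    (subset_affineSpan ℝ _ (subset_convexHull ℝ _ (Set.mem_range_self i))) hxs
  let g : (κ → ℝ) → ℝ := fun θ => ∑ i, Real.exp (θ ⬝ᵥ (p i - x))
  have hgc : Continuous g := by
    simp only [g, dotProduct]
    fun_prop
  have hbound : ∀ θ ∈ D, ε / 2 * ‖θ‖ ≤ g θ := by
    intro θ hθ
    rcases eq_or_ne θ 0 with rfl | hθ0
    · rw [norm_zero, mul_zero]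
      exact Finset.sum_nonneg fun i _ => (Real.exp_pos _).le
    have hn : 0 < ‖θ‖ := norm_pos_iff.2 hθ0
    have hz : (ε / 2 / ‖θ‖) • θ + x ∈ convexHull ℝ (Set.range p) := by
      refine hball _ (AffineSubspace.vadd_mem_of_mem_direction (D.smul_mem _ hθ) hxs) ?_
      rw [dist_eq_norm, add_sub_cancel_right, norm_smul, Real.norm_of_nonneg (by positivity),
        div_mul_cancel₀ _ hn.ne']
      exact half_lt_self hε
    obtain ⟨i, hi⟩ : ∃ i, θ ⬝ᵥ ((ε / 2 / ‖θ‖) • θ + x) ≤ θ ⬝ᵥ p i := by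
      by_contra! hlt
      have hsub : convexHull ℝ (Set.range p) ⊆
          {z | θ ⬝ᵥ z < θ ⬝ᵥ ((ε / 2 / ‖θ‖) • θ + x)} := by
        refine convexHull_min ?_ (convex_halfSpace_lt
          ⟨fun a b => dotProduct_add θ a b, fun c a => dotProduct_smul c θ a⟩ _)
        rintro _ ⟨i, rfl⟩
        exact hlt i
      exact absurd (hsub hz) (lt_irrefl (θ ⬝ᵥ ((ε / 2 / ‖θ‖) • θ + x)))
    rw [dotProduct_add, dotProduct_smul, smul_eq_mul] at hi
    have h1 : ε / 2 * ‖θ‖ ≤ θ ⬝ᵥ (p i - x) := by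
      have h2 := mul_le_mul_of_nonneg_left (norm_sq_le_dotProduct_self θ)
        (show 0 ≤ ε / 2 / ‖θ‖ by positivity)
      have h3 : ε / 2 / ‖θ‖ * ‖θ‖ ^ 2 = ε / 2 * ‖θ‖ := by
        field_simp
      rw [dotProduct_sub]
      linarith
    calc ε / 2 * ‖θ‖ ≤ θ ⬝ᵥ (p i - x) := h1
      _ ≤ θ ⬝ᵥ (p i - x) + 1 := by linarith
      _ ≤ Real.exp (θ ⬝ᵥ (p i - x)) := Real.add_one_le_exp _
      _ ≤ g θ := Finset.single_le_sum (f := fun i => Real.exp (θ ⬝ᵥ (p i - x)))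
          (fun k _ => (Real.exp_pos _).le) (Finset.mem_univ i)
  obtain ⟨⟨θ, hθ⟩, hmin⟩ : ∃ θ : D, ∀ η : D, g θ ≤ g η := by
    refine Continuous.exists_forall_le (hgc.comp continuous_subtype_val) ?_
    refine Filter.tendsto_atTop_mono (fun η : D => hbound η η.2) ?_
    exact (tendsto_norm_cocompact_atTop (E := D)).const_mul_atTop (half_pos hε)
  let q : κ → ℝ := ∑ i, Real.exp (θ ⬝ᵥ (p i - x)) • (p i - x)
  have hqD : q ∈ D := D.sum_mem fun i _ => D.smul_mem _ (hpD i)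
  have hderiv : HasDerivAt (fun s : ℝ => g (θ + s • q)) (q ⬝ᵥ q) 0 := by
    have h1 : ∀ i, HasDerivAt (fun s : ℝ => Real.exp ((θ + s • q) ⬝ᵥ (p i - x)))
        (Real.exp (θ ⬝ᵥ (p i - x)) * (q ⬝ᵥ (p i - x))) 0 := by
      intro i
      have h2 : HasDerivAt (fun s : ℝ => (θ + s • q) ⬝ᵥ (p i - x)) (q ⬝ᵥ (p i - x)) 0 := by
        simp only [add_dotProduct, smul_dotProduct, smul_eq_mul]
        simpa using ((hasDerivAt_id (0 : ℝ)).mul_const (q ⬝ᵥ (p i - x))).const_add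
          (θ ⬝ᵥ (p i - x))
      simpa using h2.exp
    have h3 := HasDerivAt.fun_sum (u := Finset.univ) fun i _ => h1 i
    refine h3.congr_deriv (Eq.symm ?_)
    have h4 : q ⬝ᵥ q = q ⬝ᵥ ∑ i, Real.exp (θ ⬝ᵥ (p i - x)) • (p i - x) := rfl
    rw [h4, dotProduct_sum]
    simp only [dotProduct_smul, smul_eq_mul]
  have hq : q ⬝ᵥ q = 0 := by
    refine IsLocalMin.hasDerivAt_eq_zero (Filter.Eventually.of_forall fun s => ?_) hderiv
    simpa using hmin ⟨θ + s • q, D.add_mem hθ (D.smul_mem s hqD)⟩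
  have hq0 : q = 0 := dotProduct_self_eq_zero.1 hq
  refine ⟨θ, ?_⟩
  have h4 : q = Real.exp (-(θ ⬝ᵥ x)) •
      (∑ i, Real.exp (θ ⬝ᵥ p i) • p i - (∑ i, Real.exp (θ ⬝ᵥ p i)) • x) := by
    rw [Finset.sum_smul, ← Finset.sum_sub_distrib, Finset.smul_sum]
    refine Finset.sum_congr rfl fun i _ => ?_
    rw [← smul_sub, smul_smul, ← Real.exp_add, dotProduct_sub]
    congr 2
    ring
  rw [h4, smul_eq_zero] at hq0
  exact sub_eq_zero.1 (hq0.resolve_left (Real.exp_pos _).ne')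

end ExponentialFamily

/-! ### Relative resistances -/

section RelativeResistance

variable {V : Type*} (G : SimpleGraph V)

lemma spanningTreePolytope_eq_range :
    spanningTreePolytope G =
      convexHull ℝ (Set.range fun T : {T // IsSpanningTree G T} => indicatorVector G T) := by
  rw [spanningTreePolytope]
  congr 1
  ext x
  constructor
  · rintro ⟨T, hT, rfl⟩
    exact ⟨⟨T, hT⟩, rfl⟩
  · rintro ⟨T, rfl⟩
    exact ⟨T, T.2, rfl⟩

variable [Fintype V]

lemma exists_isSpanningTree : ∃ T, IsSpanningTree G T := by
  have hempty : (edgeSubgraph G ∅).IsAcyclic := by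
    have : edgeSubgraph G ∅ = ⊥ := by simp [edgeSubgraph]
    rw [this]
    exact SimpleGraph.isAcyclic_bot
  obtain ⟨T, -, hT⟩ := Finite.exists_le_maximal
    (p := fun F : Finset G.edgeSet => (edgeSubgraph G F).IsAcyclic) hempty
  exact ⟨T, hT⟩

open Classical in
/-- The vector of relative resistances is the mean of the spanning trees under the weights
`∏ t ∈ T, c t`. -/
lemma relativeResistance_eq_sum_smul (c : G.edgeSet → ℝ) :
    relativeResistance G c = (∑ T : {T // IsSpanningTree G T}, ∏ t ∈ T.1, c t)⁻¹ •
      ∑ T : {T // IsSpanningTree G T}, (∏ t ∈ T.1, c t) • indicatorVector G T := by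
  have hsub : ∀ f : Finset G.edgeSet → ℝ,
      ∑ T ∈ spanningTrees G, f T = ∑ T : {T // IsSpanningTree G T}, f T := fun f =>
    Finset.sum_subtype _ (fun T => by simp [spanningTrees]) f
  ext e
  rw [relativeResistance, Finset.sum_filter, hsub, hsub, div_eq_inv_mul, Pi.smul_apply,
    smul_eq_mul, Finset.sum_apply]
  congr 1
  refine Finset.sum_congr rfl fun T _ => ?_
  simp [indicatorVector]

lemma relativeResistance_mem_openSpanningTreePolytope {c : G.edgeSet → ℝ} (hc : ∀ e, 0 < c e) :
    relativeResistance G c ∈ openSpanningTreePolytope G := by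
  classical
  obtain ⟨T₀, hT₀⟩ := exists_isSpanningTree G
  have : Nonempty {T // IsSpanningTree G T} := ⟨⟨T₀, hT₀⟩⟩
  have hprod : ∀ T : {T // IsSpanningTree G T}, 0 < ∏ t ∈ T.1, c t := fun T =>
    Finset.prod_pos fun t _ => hc t
  have hZ : 0 < ∑ T : {T // IsSpanningTree G T}, ∏ t ∈ T.1, c t :=
    Finset.sum_pos (fun T _ => hprod T) Finset.univ_nonempty
  rw [openSpanningTreePolytope, spanningTreePolytope_eq_range, relativeResistance_eq_sum_smul,
    Finset.smul_sum]
  simp only [smul_smul]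
  refine sum_smul_mem_intrinsicInterior
    (fun T : {T // IsSpanningTree G T} => indicatorVector G T)
    (fun T => mul_pos (inv_pos.2 hZ) (hprod T)) ?_
  rw [← Finset.mul_sum, inv_mul_cancel₀ hZ.ne']

lemma exists_relativeResistance_eq {x : G.edgeSet → ℝ} (hx : x ∈ openSpanningTreePolytope G) :
    ∃ c : G.edgeSet → ℝ, (∀ e, 0 < c e) ∧ relativeResistance G c = x := by
  classical
  obtain ⟨T₀, hT₀⟩ := exists_isSpanningTree G
  have : Nonempty {T // IsSpanningTree G T} := ⟨⟨T₀, hT₀⟩⟩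
  rw [openSpanningTreePolytope, spanningTreePolytope_eq_range] at hx
  obtain ⟨θ, hθ⟩ := exists_exp_sum_smul_eq _ hx
  have hexp : ∀ T : Finset G.edgeSet,
      Real.exp (θ ⬝ᵥ indicatorVector G T) = ∏ t ∈ T, Real.exp (θ t) := by
    intro T
    rw [← Real.exp_sum]
    simp [dotProduct, indicatorVector]
  simp only [hexp] at hθ
  have hZ : 0 < ∑ T : {T // IsSpanningTree G T}, ∏ t ∈ T.1, Real.exp (θ t) :=
    Finset.sum_pos (fun T _ => Finset.prod_pos fun t _ => Real.exp_pos _) Finset.univ_nonempty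
  refine ⟨fun e => Real.exp (θ e), fun e => Real.exp_pos _, ?_⟩
  rw [relativeResistance_eq_sum_smul, hθ, smul_smul, inv_mul_cancel₀ hZ.ne', one_smul]

lemma forall_resistanceCurvature_nonneg_iff (c : G.edgeSet → ℝ) :
    (∀ v, 0 ≤ resistanceCurvature G c v) ↔
      SatisfiesVertexInequalities G (relativeResistance G c) := by
  refine forall_congr' fun v => ?_
  rw [resistanceCurvature]
  constructor <;> intro h <;> linarith

theorem mem_doubleMatchingPolytope_iff {x : G.edgeSet → ℝ} (hx : x ∈ spanningTreePolytope G) :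
    x ∈ doubleMatchingPolytope G ↔ SatisfiesVertexInequalities G x :=
  ⟨satisfiesVertexInequalities_of_mem G,
    mem_doubleMatchingPolytope_of_inequalities G (satisfiesRankInequalities_of_mem G hx)⟩

theorem isResistanceNonnegative_iff :
    IsResistanceNonnegative G ↔
      (openSpanningTreePolytope G ∩ doubleMatchingPolytope G).Nonempty := by
  constructor
  · rintro ⟨c, hc, hv⟩
    have hr := relativeResistance_mem_openSpanningTreePolytope G hc
    exact ⟨_, hr, (mem_doubleMatchingPolytope_iff G (intrinsicInterior_subset hr)).2
      ((forall_resistanceCurvature_nonneg_iff G c).1 hv)⟩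
  · rintro ⟨x, hx, hx2⟩
    obtain ⟨c, hc, rfl⟩ := exists_relativeResistance_eq G hx
    exact ⟨c, hc, (forall_resistanceCurvature_nonneg_iff G c).2
      ((mem_doubleMatchingPolytope_iff G (intrinsicInterior_subset hx)).1 hx2)⟩

end RelativeResistance

end ResistanceGraph

end

theorem mainTheorem2 {V : Type*} [Fintype V] (G : SimpleGraph V) (hG : G.Connected) :
    (ResistanceGraph.IsResistanceNonnegative G ↔
      (ResistanceGraph.openSpanningTreePolytope G ∩
        ResistanceGraph.doubleMatchingPolytope G).Nonempty) ∧
    (∀ x ∈ ResistanceGraph.spanningTreePolytope G,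
      ResistanceGraph.SatisfiesRankInequalities G x) ∧
    (∀ x : G.edgeSet → ℝ, ResistanceGraph.SatisfiesRankInequalities G x →
      ResistanceGraph.SatisfiesOddSetInequalities G x) ∧
    (∀ x ∈ ResistanceGraph.spanningTreePolytope G,
      (x ∈ ResistanceGraph.doubleMatchingPolytope G ↔
        ResistanceGraph.SatisfiesVertexInequalities G x)) :=
  ⟨ResistanceGraph.isResistanceNonnegative_iff G,
    fun _ hx => ResistanceGraph.satisfiesRankInequalities_of_mem G hx,
    fun _ hx => hx.satisfiesOddSetInequalities,
    fun _ hx => ResistanceGraph.mem_doubleMatchingPolytope_iff G hx⟩
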